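/- Let $\mathcal M$ be an $\omega$-saturated model of a small complete first-order theory $T$ (that is, $T$ has at most countably many complete $n$-types for every $n$). Let $H(\mathcal M)$ be the family of universes of elementary submodels of $\mathcal M$, let $H_{\omega_1}(\mathcal M)$ be its subfamily of at most countable sets, and let $H_p(\mathcal M)$ be the subfamily of those members of $H_{\omega_1}(\mathcal M)$ that are universes of models prime over finite sets. Let $Z=\mathrm{acl}(Z_0)$ be the algebraic closure in $\mathcal M$ of some finite set $Z_0$, and let $a,b\in M\setminus Z$. Write $aZ=\{a\}\cup Z$ and $bZ=\{b\}\cup Z$. For a family $Y$ of subsets of $M$, say that $a$ and $b$ are *Hausdorff $Z$-separable in $Y$ by sets containing $Z$* if there are $y,z\in Y$ with $Z\subseteq y$, $Z\subseteq z$, $a\in y$, $b\in z$ and $(y\cap z)\setminus Z=\varnothing$; say that $a$ is *$Z$-separable from $b$ in $Y$ by a set containing $Z$* if there is $y\in Y$ with $Z\subseteq y$, $a\in y\cup Z$ and $b\notin y$. (A) The following are equivalent: 1. $a$ and $b$ are Hausdorff $Z$-separable in $H(\mathcal M)$ by sets containing $Z$; 2. $a$ and $b$ are Hausdorff $Z$-separable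 in $H_{\omega_1}(\mathcal M)$ by sets containing $Z$; 3. $a$ and $b$ are Hausdorff $Z$-separable in $H_p(\mathcal M)$ by sets containing $Z$; 4. $(\mathrm{acl}(aZ)\cap\mathrm{acl}(bZ))\setminus Z=\varnothing$. (B) The following are equivalent: 1. $a$ is $Z$-separable from $b$ in $H(\mathcal M)$ by a set containing $Z$; 2. $a$ is $Z$-separable from $b$ in $H_{\omega_1}(\mathcal M)$ by a set containing $Z$; 3. $a$ is $Z$-separable from $b$ in $H_p(\mathcal M)$ by a set containing $Z$; 4. $b\notin\mathrm{acl}(aZ)$. -/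

import Mathlib

open FirstOrder Cardinal

universe u v w

namespace ModelHypergraph

/-! ### Separability in a hypergraph `(X, Y)`, where `Y` is a family of subsets of `X` -/

/-- The set `y` separates `x₁` from `x₂` relative to `Z`. -/
def SeparatesRel {X : Type w} (Z y : Set X) (x₁ x₂ : X) : Prop :=
  x₁ ∈ y ∪ Z ∧ x₂ ∉ y

/-- The sets `y₁` and `y₂` separate `x₁` and `x₂` in the Hausdorff sense relative to `Z`. -/
def HausdorffSeparatesRel {X : Type w} (Z y₁ y₂ : Set X) (x₁ x₂ : X) : Prop :=
  (y₁ ∩ y₂) \ Z = ∅ ∧ x₁ ∈ y₁ ∧ x₂ ∈ y₂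

/-- In the hypergraph `(X, Y)`, the element `x₁` is `Z`-separable from `x₂`
by some set of `Y` containing `Z`. -/
def SeparableOver {X : Type w} (Y : Set (Set X)) (Z : Set X) (x₁ x₂ : X) : Prop :=
  ∃ y ∈ Y, Z ⊆ y ∧ SeparatesRel Z y x₁ x₂

/-- In the hypergraph `(X, Y)`, the elements `x₁` and `x₂` are (Hausdorff) `Z`-separable
by some sets of `Y` containing `Z`. -/
def HausdorffSeparableOver {X : Type w} (Y : Set (Set X)) (Z : Set X) (x₁ x₂ : X) : Prop :=
  ∃ y₁ ∈ Y, ∃ y₂ ∈ Y, Z ⊆ y₁ ∧ Z ⊆ y₂ ∧ HausdorffSeparatesRel Z y₁ y₂ x₁ x₂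

/-! ### Model-theoretic notions -/

variable (L : FirstOrder.Language.{u, v})

/-- A theory is small if it has at most countably many complete `n`-types for every `n`. -/
def IsSmall {L : FirstOrder.Language.{u, v}} (T : L.Theory) : Prop :=
  ∀ n : ℕ, Countable (T.CompleteType (Fin n))

variable (M : Type w) [L.Structure M]

/-- A structure `M` is `ω`-saturated if every `1`-type over a finite set `A` of parameters
(a set of formulas in one variable over `A` that is finitely satisfiable in `M`)
is realized in `M`. -/
def IsOmegaSaturated : Prop :=
  ∀ A : Set M, A.Finite → ∀ Γ : Set (L[[A]].Formula (Fin 1)),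
    (∀ Δ : Finset (L[[A]].Formula (Fin 1)), (Δ : Set (L[[A]].Formula (Fin 1))) ⊆ Γ →
      ∃ c : M, ∀ φ ∈ Δ, φ.Realize (fun _ => c)) →
    ∃ c : M, ∀ φ ∈ Γ, φ.Realize (fun _ => c)

variable {M}

/-- The algebraic closure of `A` in `M`: the union of all finite `A`-definable subsets. -/
def acl (A : Set M) : Set M :=
  {x | ∃ s : Set M, A.Definable₁ L s ∧ s.Finite ∧ x ∈ s}

variable (M)

/-- The structure `M` is prime over its subset `A`: every partial elementary map from `A` to
a structure `K` extends to an elementary embedding of `M` into `K`. By the downward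
Löwenheim–Skolem theorem it makes no difference that `K` ranges over one universe only, as
this universe is large enough for `L` and `M`. -/
def IsPrimeOver (A : Set M) : Prop :=
  ∀ (K : Type (max u v w)) [L.Structure K] (f : A → K),
    (∀ φ : L.Formula A, φ.Realize (fun x : A => (x : M)) ↔ φ.Realize f) →
    ∃ g : M ↪ₑ[L] K, ∀ x : A, g x = f x

/-- `H(M)`: the family of universes of elementary submodels of `M`. -/
def H : Set (Set M) :=
  {N | ∃ S : L.ElementarySubstructure M, (S : Set M) = N}

/-- `H_κ(M)`: the members of `H(M)` of cardinality less than `κ`. -/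
def HCard (κ : Cardinal.{w}) : Set (Set M) :=
  {N | N ∈ H L M ∧ #N < κ}

/-- `H_p(M)`: the members of `H_{ω₁}(M)` that are universes of elementary submodels
prime over some finite set. -/
def HPrime : Set (Set M) :=
  {N | N ∈ HCard L M ℵ₁ ∧ ∃ S : L.ElementarySubstructure M, (S : Set M) = N ∧
    ∃ A : Set S, A.Finite ∧ IsPrimeOver L S A}

end ModelHypergraph

/-!
An elementary submodel containing a set also contains its algebraic closure, so separability in any
of the three families forces the algebraic closures to be separated. The converse is
`exists_mem_HPrime_inter_subset`: finite sets `A` and `B` lie in countable elementary submodels,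
prime over finite sets, whose intersection is contained in `acl A ∩ acl B`. Hausdorff separability
is the case `A = {a} ∪ Z₀`, `B = {b} ∪ Z₀`, and separability the case `A = {a} ∪ Z₀`, `B = {b}`.

The two submodels are built together inside `M`, as `A ∪ {c₀, c₁, …}` and `B ∪ {d₀, d₁, …}`. Each
new term realizes an isolated type over the finite set already present on its own side, which makes
the resulting models prime over `A` and `B`. Isolated types are dense by smallness and saturation
(`exists_isAtomOver_subset`), and by smallness only countably many definable sets need to be met for
the Tarski–Vaught test to succeed (`exists_countable_base`).

The intersection is controlled by keeping what is algebraic over both finite stages inside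
`acl A ∩ acl B`. That an isolated type has a realization preserving this is a form of
P. M. Neumann's lemma, `exists_acl_insert_inter_subset`. By saturation it reduces to a statement
about a uniformly `A`-definable family of finite sets, `exists_mem_acl_of_isTransversal`: a finite
set that meets all members of the family contains a point algebraic over `A`. The reason is
combinatorial: a family of finite sets has only finitely many minimal transversals of a given size,
so the points on them form a finite `A`-definable set.
-/

namespace ModelHypergraph

open Set FirstOrder.Language

section Construction

variable {L : FirstOrder.Language.{u, v}} {M : Type w} [L.Structure M] {A B : Set M}

/-! ### Definable sets -/

theorem definable_range_iff {α β : Type*} {p : β → M} {s : Set (α → M)} :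
    (range p).Definable L s ↔
      ∃ φ : L.Formula (β ⊕ α), ∀ x, x ∈ s ↔ φ.Realize (Sum.elim p x) := by
  rw [definable_iff_exists_formula_sum]
  constructor
  · rintro ⟨φ, rfl⟩
    refine ⟨φ.relabel (Sum.map (fun y => y.2.choose) id), fun x => ?_⟩
    rw [Formula.realize_relabel, mem_ofPred_eq]
    congr! 1
    ext (y | y)
    · exact y.2.choose_spec.symm
    · rfl
  · rintro ⟨φ, hφ⟩
    refine ⟨φ.relabel (Sum.map (rangeFactorization p) id), ?_⟩
    ext x
    rw [mem_ofPred_eq, Formula.realize_relabel, hφ]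
    congr! 1
    ext (y | y) <;> rfl

theorem definable₁_range_iff {β : Type*} {p : β → M} {s : Set M} :
    (range p).Definable₁ L s ↔
      ∃ φ : L.Formula (β ⊕ Fin 1), ∀ x, x ∈ s ↔ φ.Realize (Sum.elim p fun _ => x) := by
  rw [Definable₁, definable_range_iff]
  refine exists_congr fun φ => ⟨fun h x => h fun _ => x, fun h x => ?_⟩
  rw [mem_ofPred_eq, h]
  congr!

theorem definable₁_inter {s t : Set M} (hs : A.Definable₁ L s) (ht : A.Definable₁ L t) :
    A.Definable₁ L (s ∩ t) :=
  Definable.inter hs ht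

theorem definable₁_union {s t : Set M} (hs : A.Definable₁ L s) (ht : A.Definable₁ L t) :
    A.Definable₁ L (s ∪ t) :=
  Definable.union hs ht

theorem definable₁_diff {s t : Set M} (hs : A.Definable₁ L s) (ht : A.Definable₁ L t) :
    A.Definable₁ L (s \ t) :=
  Definable.sdiff hs ht

theorem definable₁_univ : A.Definable₁ L (univ : Set M) :=
  definable_univ

theorem definable₁_empty : A.Definable₁ L (∅ : Set M) :=
  definable_empty

theorem definable₁_biUnion {ι : Type*} {t : Set ι} (ht : t.Finite) {s : ι → Set M}
    (hs : ∀ i ∈ t, A.Definable₁ L (s i)) : A.Definable₁ L (⋃ i ∈ t, s i) := by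
  induction t, ht using Set.Finite.induction_on with
  | empty => simpa using definable₁_empty
  | insert _ _ ih =>
    rw [biUnion_insert]
    exact definable₁_union (hs _ (mem_insert _ _)) (ih fun i hi => hs i (mem_insert_of_mem _ hi))

theorem definable₁_of_finite {s : Set M} (hs : s.Finite) (hsA : s ⊆ A) : A.Definable₁ L s := by
  rw [← biUnion_of_singleton s]
  exact definable₁_biUnion hs fun x hx => Definable.singleton_of_mem L (hsA hx)

/-- The form of `ω`-saturation used below: a family of sets definable over a finite set with the
finite intersection property has a common point. -/
theorem IsOmegaSaturated.exists_forall_mem (hsat : IsOmegaSaturated L M) (hA : A.Finite)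
    {ι : Type*} {s : ι → Set M} (hs : ∀ i, A.Definable₁ L (s i))
    (hfin : ∀ t : Finset ι, ∃ x, ∀ i ∈ t, x ∈ s i) : ∃ x, ∀ i, x ∈ s i := by
  classical
  choose φ hφ using hs
  have key : ∀ i x, x ∈ s i ↔ (φ i).Realize fun _ => x := fun i x => by
    have := Set.ext_iff.1 (hφ i) fun _ => x
    simpa using this
  obtain ⟨c, hc⟩ := hsat A hA (range φ) fun Δ hΔ => by
    choose g hg using fun ψ : Δ => hΔ ψ.2
    obtain ⟨x, hx⟩ := hfin (Finset.univ.image g)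
    refine ⟨x, fun ψ hψ => ?_⟩
    rw [← show φ (g ⟨ψ, hψ⟩) = ψ from hg ⟨ψ, hψ⟩]
    exact (key _ _).1 (hx _ (Finset.mem_image_of_mem g (Finset.mem_univ _)))
  exact ⟨c, fun i => (key i c).2 (hc _ (mem_range_self i))⟩

/-! ### Algebraic closure -/

theorem acl_mono (h : A ⊆ B) : acl L A ⊆ acl L B :=
  fun _ ⟨s, hs, hfin, hx⟩ => ⟨s, Definable.mono hs h, hfin, hx⟩

theorem subset_acl : A ⊆ acl L A :=
  fun x hx => ⟨{x}, Definable.singleton_of_mem L hx, finite_singleton x, rfl⟩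

/-- The points of a finite set that are algebraic over `A` lie in a single finite `A`-definable
set. -/
theorem exists_definable_finite_cover {D : Set M} (hD : D.Finite) :
    ∃ F : Set M, A.Definable₁ L F ∧ F.Finite ∧ D ∩ acl L A ⊆ F ∧ F ⊆ acl L A := by
  choose! s hs hfin hmem using fun x (hx : x ∈ D ∩ acl L A) => hx.2
  have hdef := definable₁_biUnion (hD.inter_of_left (acl L A)) hs
  have hF := (hD.inter_of_left (acl L A)).biUnion hfin
  exact ⟨_, hdef, hF, fun x hx => mem_biUnion hx (hmem x hx), fun x hx => ⟨_, hdef, hF, hx⟩⟩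

theorem acl_subset_of_meetsDefinable {N : Set M} (hN : L.MeetsDefinable N) (hA : A ⊆ N) :
    acl L A ⊆ N := by
  rintro x ⟨s, hs, hfin, hx⟩
  by_contra hxN
  obtain ⟨y, hy, hyN⟩ := hN (s \ (s ∩ N)) ⟨x, hx, fun h => hxN h.2⟩
    (definable₁_diff (Definable.mono hs hA)
      (definable₁_of_finite (hfin.inter_of_left N) inter_subset_right))
  exact hy.2 ⟨hy.1, hyN⟩

theorem acl_subset_of_mem_H {N : Set M} (hN : N ∈ H L M) (hA : A ⊆ N) : acl L A ⊆ N := by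
  obtain ⟨S, rfl⟩ := hN
  exact acl_subset_of_meetsDefinable S.meetsDefinable hA

/-! ### Uniformly definable families of finite sets -/

/-- The family of sets `E x` is uniformly definable over `A`. -/
def IsDefinableFamily (L : FirstOrder.Language.{u, v}) [L.Structure M] (A : Set M)
    (E : M → Set M) : Prop :=
  A.Definable₂ L {p | p.2 ∈ E p.1}

theorem IsDefinableFamily.definable {E : M → Set M} (hE : IsDefinableFamily L A E) {α : Type*}
    (i j : α) : A.Definable L {v : α → M | v j ∈ E (v i)} := 
  Definable.preimage_comp ![i, j] hE

theorem definable_of_definable₁ {C : Set M} (hC : A.Definable₁ L C) {α : Type*} (i : α) :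
    A.Definable L {v : α → M | v i ∈ C} := 
  Definable.preimage_comp ![i] hC

theorem IsDefinableFamily.inter {E E' : M → Set M} (hE : IsDefinableFamily L A E)
    (hE' : IsDefinableFamily L A E') : IsDefinableFamily L A fun x => E x ∩ E' x :=
  Definable.inter hE hE'

theorem IsDefinableFamily.biUnion {ι : Type*} {t : Finset ι} {E : ι → M → Set M}
    (hE : ∀ i, IsDefinableFamily L A (E i)) : IsDefinableFamily L A fun x => ⋃ i ∈ t, E i x := by
  have := definable_biUnion_finset hE t
  rw [IsDefinableFamily, Definable₂]
  convert this using 1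
  ext; simp

theorem isDefinableFamily_const {C : Set M} (hC : A.Definable₁ L C) :
    IsDefinableFamily L A fun x => {_y | x ∈ C} :=
  definable_of_definable₁ hC (0 : Fin 2)

/-- The indices `x` for which `E x` has at most `k` elements form a definable set. -/
theorem IsDefinableFamily.definable_encard_le {E : M → Set M} (hE : IsDefinableFamily L A E)
    (k : ℕ) : A.Definable₁ L {x | (E x).encard ≤ k} := by
  have h₁ : A.Definable L (⋃ i : Fin (k + 1),
      {v : Fin 1 ⊕ Fin (k + 1) → M | v (Sum.inr i) ∈ E (v (Sum.inl 0))}ᶜ) :=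
    definable_iUnion_of_finite fun i => (hE.definable _ _).compl
  have h₂ : A.Definable L (⋃ i : {q : Fin (k + 1) × Fin (k + 1) // q.1 ≠ q.2},
      {v : Fin 1 ⊕ Fin (k + 1) → M | v (Sum.inr i.1.1) = v (Sum.inr i.1.2)}) :=
    definable_iUnion_of_finite fun i =>
      Definable.preimage_comp ![Sum.inr i.1.1, Sum.inr i.1.2] (Definable.diagonal L A)
  have h := (h₁.union h₂).forall_of_finite
  rw [Definable₁]
  convert h using 1
  ext x
  simp only [mem_ofPred_eq, mem_union, mem_iUnion, mem_compl_iff, Sum.elim_inr, Sum.elim_inl,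
    Subtype.exists, Prod.exists]
  rw [← not_iff_not, not_le, ← ENat.add_one_le_iff (by simp)]
  push Not
  constructor
  · intro hk
    obtain ⟨t, ht, htk⟩ := exists_subset_encard_eq hk
    have htf : t.Finite := finite_of_encard_le_coe (k := k + 1) (by simp [htk])
    have := htf.to_subtype
    have hcard : Nat.card t = k + 1 := by
      rw [Nat.card_coe_set_eq, ← ENat.natCast_inj, htf.cast_ncard_eq, htk]; simp
    let e := (Finite.equivFinOfCardEq hcard).symm
    exact ⟨fun i => e i, fun i => ht (e i).2, fun i j hij h => hij (e.injective (Subtype.ext h))⟩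
  · rintro ⟨u, hu, hinj⟩
    have hu' : Function.Injective u := fun i j hij => by
      by_contra h
      exact hinj i j h hij
    have : (range u).encard = k + 1 := by
      rw [← image_univ, hu'.encard_image]; simp
    rw [← this]
    exact encard_le_encard (range_subset_iff.2 hu)

/-- A finite set definable over `insert c A` is the fibre at `c` of a family of finite sets that
is uniformly definable over `A`. -/
theorem exists_isDefinableFamily {c : M} {s : Set M} (hs : (insert c A).Definable₁ L s)
    (hfin : s.Finite) :
    ∃ E : M → Set M, IsDefinableFamily L A E ∧ (∀ x, (E x).Finite) ∧ E c = s := by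
  classical
  obtain ⟨φ, hφ⟩ := definable_iff_exists_formula_sum.1 hs
  let r : (insert c A : Set M) ⊕ Fin 1 → A ⊕ Fin 2 :=
    Sum.elim (fun y => if h : (y : M) ∈ A then Sum.inl ⟨y, h⟩ else Sum.inr 0) fun _ => Sum.inr 1
  let E : M → Set M := fun x => {y | (φ.relabel r).Realize (Sum.elim (↑) ![x, y])}
  have hE : IsDefinableFamily L A E := by
    refine definable_iff_exists_formula_sum.2 ⟨φ.relabel r, ?_⟩
    ext x
    simp only [E, mem_ofPred_eq]
    congr! 2
    ext i; fin_cases i <;> rfl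
  have hEc : E c = s := by
    ext y
    have := Set.ext_iff.1 hφ fun _ => y
    simp only [mem_ofPred_eq] at this
    rw [this]
    simp only [E, mem_ofPred_eq, Formula.realize_relabel]
    congr! 1
    ext (⟨z, hz⟩ | z)
    · by_cases h : z ∈ A
      · simp [r, h]
      · obtain rfl := (mem_insert_iff.1 hz).resolve_right h
        simp [r, h]
    · simp [r]
  -- Restrict to the fibres with at most as many elements as `s`.
  refine ⟨fun x => E x ∩ {_y | x ∈ {x | (E x).encard ≤ s.ncard}},
    hE.inter (isDefinableFamily_const (hE.definable_encard_le _)), fun x => ?_, ?_⟩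
  · by_cases h : (E x).encard ≤ s.ncard
    · exact (finite_of_encard_le_coe h).inter_of_left _
    · simp [h]
  · simp [hEc, hfin.cast_ncard_eq]

/-! ### Transversals of families of finite sets -/

/-- `T` meets every member of the family `E` indexed by `C`. -/
def IsTransversal {X Y : Type*} (C : Set X) (E : X → Set Y) (T : Set Y) : Prop :=
  ∀ x ∈ C, (T ∩ E x).Nonempty

/-- A family of finite sets has only finitely many minimal transversals of a given size.
A transversal containing `S` must contain, besides `S`, an element of any given member
of the family that `S` misses; this allows only finitely many choices. -/
theorem finite_minimal_transversals {X Y : Type*} {C : Set X} {E : X → Set Y}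
    (hE : ∀ x ∈ C, (E x).Finite) (n : ℕ) (S : Set Y) :
    {T : Set Y | Minimal (IsTransversal C E) T ∧ S ⊆ T ∧ (T \ S).encard ≤ n}.Finite := by
  induction n generalizing S with
  | zero =>
    refine (finite_singleton S).subset ?_
    rintro T ⟨-, hST, h⟩
    simp only [Nat.cast_zero, nonpos_iff_eq_zero, encard_eq_zero, sdiff_eq_empty] at h
    exact h.antisymm hST
  | succ n ih =>
    by_cases hS : IsTransversal C E S
    · refine (finite_singleton S).subset ?_
      rintro T ⟨hT, hST, -⟩
      exact (hT.2 hS hST).antisymm hST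
    · obtain ⟨x, hx, hSx⟩ : ∃ x ∈ C, ¬ (S ∩ E x).Nonempty := by
        simpa [IsTransversal] using hS
      refine ((hE x hx).biUnion fun y _ => ih (insert y S)).subset ?_
      rintro T ⟨hT, hST, h⟩
      obtain ⟨y, hyT, hy⟩ := hT.1 x hx
      refine mem_biUnion hy ⟨hT, insert_subset hyT hST, ?_⟩
      have hyS : y ∉ S := fun hyS => hSx ⟨y, hyS, hy⟩
      have heq : insert y (T \ insert y S) = T \ S := by
        ext z
        by_cases hz : z = y
        · simp [hz, hyT, hyS]
        · simp [hz]
      rw [← heq, encard_insert_of_notMem (by simp)] at h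
      push_cast at h
      exact (ENat.add_le_add_iff_right (by simp)).1 h

theorem definable_isTransversal {C : Set M} (hC : A.Definable₁ L C) {E : M → Set M}
    (hE : IsDefinableFamily L A E) {n : ℕ} (J : Set (Fin n)) :
    A.Definable L {t : Fin n → M | IsTransversal C E (t '' J)} := by
  have h₁ : A.Definable L {v : Fin n ⊕ Fin 1 → M | v (Sum.inr 0) ∈ C}ᶜ :=
    (definable_of_definable₁ hC _).compl
  have h₂ : A.Definable L (⋃ j : J, {v : Fin n ⊕ Fin 1 → M | v (Sum.inl j) ∈ E (v (Sum.inr 0))}) :=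
    definable_iUnion_of_finite fun j => hE.definable _ _
  convert (h₁.union h₂).forall_of_finite using 1
  ext t
  simp only [IsTransversal, mem_ofPred_eq, mem_union, mem_compl_iff, mem_iUnion, Sum.elim_inl,
    Sum.elim_inr, ← imp_iff_not_or]
  constructor
  · intro h u hu
    obtain ⟨_, ⟨j, hj, rfl⟩, hy⟩ := h (u 0) hu
    exact ⟨⟨j, hj⟩, hy⟩
  · intro h x hx
    obtain ⟨j, hj⟩ := h (fun _ => x) hx
    exact ⟨t j, mem_image_of_mem t j.2, hj⟩

/-- A finite transversal of a nonempty uniformly `A`-definable family of finite sets contains a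
point algebraic over `A`. Indeed it contains a minimal transversal, and the points that belong to
a minimal transversal of a given size form a finite `A`-definable set. -/
theorem exists_mem_acl_of_isTransversal {C : Set M} (hC : A.Definable₁ L C) (hne : C.Nonempty)
    {E : M → Set M} (hE : IsDefinableFamily L A E) (hfin : ∀ x, (E x).Finite)
    {D : Set M} (hD : D.Finite) (hDE : IsTransversal C E D) : (D ∩ acl L A).Nonempty := by
  obtain ⟨T, hTD, hT⟩ : ∃ T ⊆ D, Minimal (IsTransversal C E) T := by
    obtain ⟨T, hT⟩ := (hD.finite_subsets.inter_of_left {T | IsTransversal C E T}).exists_minimal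
      ⟨D, Subset.rfl, hDE⟩
    exact ⟨T, hT.1.1, hT.1.2, fun T' h h' => hT.2 ⟨h'.trans hT.1.1, h⟩ h'⟩
  obtain ⟨x₀, hx₀⟩ := hne
  obtain ⟨y, hyT, -⟩ := hT.1 x₀ hx₀
  obtain ⟨n, e, hinj, rfl⟩ := (hD.subset hTD).fin_param
  obtain ⟨i, rfl⟩ := hyT
  -- `W` consists of the enumerations of minimal transversals by `Fin n`.
  let W : Set (Fin n → M) := {t | IsTransversal C E (t '' univ)} ∩
    ⋂ j, {t | IsTransversal C E (t '' {j}ᶜ)}ᶜ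
  have hWdef : A.Definable L W := (definable_isTransversal hC hE _).inter
    (definable_iInter_of_finite fun j => (definable_isTransversal hC hE _).compl)
  have heW : e ∈ W := by
    refine ⟨by simpa using hT.1, mem_iInter.2 fun j hj => ?_⟩
    obtain ⟨k, hk, hkj⟩ := hT.2 hj (image_subset_range _ _) (mem_range_self j)
    exact hk (hinj hkj)
  have hmin : ∀ t ∈ W, Minimal (IsTransversal C E) (range t) := by
    rintro t ⟨ht, ht'⟩
    refine ⟨by simpa using ht, fun T' hT' hsub => ?_⟩
    rintro _ ⟨j, rfl⟩
    by_contra hj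
    refine mem_iInter.1 ht' j fun x hx => (hT' x hx).mono ?_
    refine inter_subset_inter_left _ fun z hz => ?_
    obtain ⟨k, rfl⟩ := hsub hz
    exact ⟨k, fun hkj => hj (hkj ▸ hz), rfl⟩
  have hWfin : W.Finite := by
    have hU := (finite_minimal_transversals (C := C) (fun x _ => hfin x) n ∅).biUnion
      (t := id) fun T' hT' => finite_of_encard_le_coe (k := n) (by simpa using hT'.2.2)
    refine (Finite.pi' fun _ : Fin n => hU).subset fun t ht j => ?_
    refine mem_biUnion (x := range t) ⟨hmin t ht, empty_subset _, ?_⟩ (mem_range_self j)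
    rw [sdiff_empty, ← image_univ]
    exact (encard_image_le _ _).trans (by simp)
  refine ⟨e i, hTD (mem_range_self i), (fun t => t i) '' W, ?_, hWfin.image _, e, heW, rfl⟩
  rw [Definable₁]
  convert hWdef.image_comp fun _ : Fin 1 => i using 1
  ext x
  simp only [mem_ofPred_eq, mem_image]
  refine exists_congr fun t => and_congr_right fun _ => ⟨fun h => ?_, fun h => h ▸ rfl⟩
  ext k
  rw [Subsingleton.elim k 0, ← h]
  rfl

theorem IsDefinableFamily.definable_inter_nonempty {E : M → Set M} (hE : IsDefinableFamily L A E)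
    {D : Set M} (hD : A.Definable₁ L D) : A.Definable₁ L {x | (D ∩ E x).Nonempty} := by
  have h : A.Definable L ({v : Fin 1 ⊕ Fin 1 → M | v (Sum.inr 0) ∈ D} ∩
      {v | v (Sum.inr 0) ∈ E (v (Sum.inl 0))}) :=
    (definable_of_definable₁ hD _).inter (hE.definable _ _)
  rw [Definable₁]
  convert h.exists_of_finite using 1
  ext x
  exact ⟨fun ⟨y, hy⟩ => ⟨fun _ => y, hy⟩, fun ⟨u, hu⟩ => ⟨u 0, hu⟩⟩

/-- A form of P. M. Neumann's lemma: over finite `A` and `B`, every nonempty `A`-definable set has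
a point `c` such that no point algebraic over `B` but not over `A` becomes algebraic over
`A ∪ {c}`. -/
theorem exists_acl_insert_inter_subset (hsat : IsOmegaSaturated L M) (hA : A.Finite)
    (hB : B.Finite) {C : Set M} (hC : A.Definable₁ L C) (hne : C.Nonempty) :
    ∃ c ∈ C, acl L (insert c A) ∩ acl L B ⊆ acl L A := by
  -- It suffices that the fibre at `c` of every uniformly `A`-definable family `E` of finite sets
  -- misses every finite `A ∪ B`-definable set `D` disjoint from `acl A`.
  let ι := {q : Set M × (M → Set M) // (A ∪ B).Definable₁ L q.1 ∧ q.1.Finite ∧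
    Disjoint q.1 (acl L A) ∧ IsDefinableFamily L A q.2 ∧ ∀ x, (q.2 x).Finite}
  obtain ⟨c, hc⟩ := hsat.exists_forall_mem (hA.union hB)
    (s := fun o : Option ι => o.elim C fun q => {x | (q.1.1 ∩ q.1.2 x).Nonempty}ᶜ) (by
      rintro (_ | ⟨⟨D, E⟩, hD, -, -, hE, -⟩)
      · exact Definable.mono hC subset_union_left
      · refine Definable.compl (IsDefinableFamily.definable_inter_nonempty ?_ hD)
        exact Definable.mono hE subset_union_left) (by
      classical
      intro t
      let u : Finset ι := t.eraseNone
      have hE : IsDefinableFamily L A fun x => ⋃ q ∈ u, q.1.2 x :=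
        IsDefinableFamily.biUnion fun q => q.2.2.2.2.1
      have hD : (⋃ q ∈ u, q.1.1).Finite := u.finite_toSet.biUnion fun q _ => q.2.2.1
      by_contra! hcon
      obtain ⟨y, hy, hyA⟩ := exists_mem_acl_of_isTransversal hC hne hE
        (fun x => u.finite_toSet.biUnion fun q _ => q.2.2.2.2.2 x) hD fun x hx => by
          obtain ⟨_ | q, hqt, hq⟩ := hcon x
          · exact (hq hx).elim
          · obtain ⟨y, hy⟩ := not_not.1 hq
            have hqu : q ∈ u := Finset.mem_eraseNone.2 hqt
            exact ⟨y, mem_biUnion hqu hy.1, mem_biUnion hqu hy.2⟩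
      obtain ⟨q, -, hyq⟩ := mem_iUnion₂.1 hy
      exact disjoint_left.1 q.2.2.2.1 hyq hyA)
  refine ⟨c, hc none, ?_⟩
  rintro y ⟨⟨s, hs, hsfin, hys⟩, ⟨D, hD, hDfin, hyD⟩⟩
  by_contra hyA
  obtain ⟨E, hE, hEfin, rfl⟩ := exists_isDefinableFamily hs hsfin
  obtain ⟨F, hF, -, hDF, hFA⟩ := exists_definable_finite_cover (L := L) (A := A) hDfin
  refine hc (some ⟨(D \ F, E), ?_, hDfin.sdiff, ?_, hE, hEfin⟩) ⟨y, ⟨hyD, fun h => hyA (hFA h)⟩, hys⟩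
  · exact definable₁_diff (Definable.mono hD subset_union_right)
      (Definable.mono hF subset_union_left)
  · exact disjoint_left.2 fun z hz hzA => hz.2 (hDF ⟨hz.1, hzA⟩)

/-! ### Isolated types over finite sets -/

/-- In a model of a small theory, countably many points realize all `1`-types over a given
finite set that are realized in the model. -/
theorem exists_seq_realizing_types {T : L.Theory} (hsmall : IsSmall T) (hM : M ⊨ T) [Nonempty M]
    (hA : A.Finite) :
    ∃ m : ℕ → M, ∀ x, ∃ n, ∀ s, A.Definable₁ L s → (x ∈ s ↔ m n ∈ s) := by
  obtain ⟨k, p, -, rfl⟩ := hA.fin_param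
  have := hsmall (k + 1)
  let τ : M → T.CompleteType (Fin (k + 1)) := fun x =>
    T.typeOf (Sum.elim p (fun _ : Fin 1 => x) ∘ finSumFinEquiv.symm)
  obtain ⟨e, he⟩ := (to_countable (range τ)).exists_eq_range (range_nonempty τ)
  choose m hm using fun n => show e n ∈ range τ from he ▸ mem_range_self n
  refine ⟨m, fun x => ?_⟩
  obtain ⟨n, hn⟩ : τ x ∈ range e := he ▸ mem_range_self x
  refine ⟨n, fun s hs => ?_⟩
  obtain ⟨φ, hφ⟩ := definable₁_range_iff.1 hs
  have key : ∀ y, y ∈ s ↔ Formula.equivSentence (φ.relabel finSumFinEquiv) ∈ τ y := fun y => by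
    rw [Theory.CompleteType.formula_mem_typeOf, Formula.realize_relabel, Function.comp_assoc,
      Equiv.symm_comp_self, Function.comp_id, hφ]
  rw [key, key, hm, hn]

/-- `s` is an atom of the Boolean algebra of `A`-definable sets; these are the sets of realizations
of the isolated types over `A`. -/
def IsAtomOver (L : FirstOrder.Language.{u, v}) [L.Structure M] (A s : Set M) : Prop :=
  A.Definable₁ L s ∧ s.Nonempty ∧ ∀ t, A.Definable₁ L t → (s ∩ t).Nonempty → s ⊆ t

/-- Isolated types over a finite set are dense. Otherwise there is a decreasing sequence of
nonempty definable sets whose `n`-th term avoids the `n`-th type; by saturation it has a common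
point, which realizes none of the types. -/
theorem exists_isAtomOver_subset {T : L.Theory} (hsmall : IsSmall T) (hM : M ⊨ T)
    (hsat : IsOmegaSaturated L M) (hA : A.Finite) {C : Set M} (hC : A.Definable₁ L C)
    (hne : C.Nonempty) : ∃ s ⊆ C, IsAtomOver L A s := by
  have : Nonempty M := hne.to_subtype.map Subtype.val
  obtain ⟨m, hm⟩ := exists_seq_realizing_types hsmall hM hA
  by_contra! hcon
  let X := {s : Set M // s ⊆ C ∧ A.Definable₁ L s ∧ s.Nonempty}
  have step : ∀ (n : ℕ) (s : X), ∃ s' : X, s'.1 ⊆ s.1 ∧ m n ∉ s'.1 := by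
    rintro n ⟨s, hsC, hs, hsne⟩
    have := hcon s hsC
    simp only [IsAtomOver, hs, hsne, true_and] at this
    push Not at this
    obtain ⟨t, ht, hst, hnst⟩ := this
    by_cases hmt : m n ∈ t
    · exact ⟨⟨s \ t, sdiff_subset.trans hsC, definable₁_diff hs ht, sdiff_nonempty.2 hnst⟩,
        sdiff_subset, fun h => h.2 hmt⟩
    · exact ⟨⟨s ∩ t, inter_subset_left.trans hsC, definable₁_inter hs ht, hst⟩,
        inter_subset_left, fun h => hmt h.2⟩
  choose g hg hgm using step
  let S : ℕ → X := fun n => Nat.rec ⟨C, Subset.rfl, hC, hne⟩ g n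
  have hS : Antitone fun n => (S n).1 := antitone_nat_of_succ_le fun n => hg n (S n)
  obtain ⟨x, hx⟩ := hsat.exists_forall_mem hA (s := fun n => (S n).1) (fun n => (S n).2.2.1)
    fun t => by
      obtain ⟨y, hy⟩ := (S (t.sup id)).2.2.2
      exact ⟨y, fun n hn => hS (Finset.le_sup (f := id) hn) hy⟩
  obtain ⟨n, hn⟩ := hm x
  exact hgm n (S n) ((hn _ (S (n + 1)).2.2.1).1 (hx (n + 1)))

/-- Every nonempty `A`-definable set contains one of countably many nonempty `A`-definable sets.
The language may be uncountable: smallness is what bounds the number of sets to be met. -/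
theorem exists_countable_base {T : L.Theory} (hsmall : IsSmall T) (hM : M ⊨ T) [Nonempty M]
    (hsat : IsOmegaSaturated L M) (hA : A.Finite) :
    ∃ U : ℕ → Set M, (∀ n, A.Definable₁ L (U n) ∧ (U n).Nonempty) ∧
      ∀ C, A.Definable₁ L C → C.Nonempty → ∃ n, U n ⊆ C := by
  obtain ⟨m, hm⟩ := exists_seq_realizing_types hsmall hM hA
  have : ∀ n, ∃ s, (A.Definable₁ L s ∧ s.Nonempty) ∧
      ∀ t, IsAtomOver L A t → m n ∈ t → s ⊆ t := fun n => by
    by_cases h : ∃ s, IsAtomOver L A s ∧ m n ∈ s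
    · obtain ⟨s, hs, hns⟩ := h
      exact ⟨s, ⟨hs.1, hs.2.1⟩, fun t ht hnt => hs.2.2 t ht.1 ⟨_, hns, hnt⟩⟩
    · exact ⟨univ, ⟨definable₁_univ, univ_nonempty⟩, fun t ht hnt => (h ⟨t, ht, hnt⟩).elim⟩
  choose U hU hU' using this
  refine ⟨U, hU, fun C hC hne => ?_⟩
  obtain ⟨s, hsC, hs⟩ := exists_isAtomOver_subset hsmall hM hsat hA hC hne
  obtain ⟨x, hx⟩ := hs.2.1
  obtain ⟨n, hn⟩ := hm x
  exact ⟨n, (hU' n s hs ((hn s hs.1).1 hx)).trans hsC⟩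

/-! ### Construction of two countable models with small intersection -/

/-- Recursive choice of a sequence, for a condition on its initial segments. -/
theorem exists_seq_of_update {X : Type*} {R : ℕ → (ℕ → X) → Prop}
    (hloc : ∀ n p p', (∀ i < n, p i = p' i) → R n p → R n p') {p₀ : ℕ → X} (h₀ : R 0 p₀)
    (step : ∀ n p, R n p → ∃ x, R (n + 1) (Function.update p n x)) : ∃ q, ∀ n, R n q := by
  have : Nonempty X := ⟨p₀ 0⟩
  choose! x hx using step
  let P : ℕ → ℕ → X := fun n => Nat.rec p₀ (fun n p => Function.update p n (x n p)) n
  have hP : ∀ n, P (n + 1) = Function.update (P n) n (x n (P n)) := fun n => rfl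
  have hR : ∀ n, R n (P n) := fun n => by
    induction n with
    | zero => exact h₀
    | succ n ih => exact hP n ▸ hx n _ ih
  have hstab : ∀ n, ∀ i < n, P n i = P (i + 1) i := fun n => by
    induction n with
    | zero => simp
    | succ n ih =>
      intro i hi
      obtain hi | rfl := Nat.lt_succ_iff_lt_or_eq.1 hi
      · rw [hP, Function.update_of_ne hi.ne, ih i hi]
      · rfl
  exact ⟨fun n => P (n + 1) n, fun n => hloc n _ _ (hstab n) (hR n)⟩

/-- The set `A` together with the first `n` terms of the sequence `c`. -/
def stage (A : Set M) (c : ℕ → M) (n : ℕ) : Set M :=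
  A ∪ c '' Iio n

theorem stage_zero (c : ℕ → M) : stage A c 0 = A := by
  simp [stage]

theorem stage_succ (c : ℕ → M) (n : ℕ) : stage A c (n + 1) = insert (c n) (stage A c n) := by
  rw [stage, stage, ← Order.succ_eq_add_one, Order.Iio_succ_eq_insert, image_insert_eq,
    union_insert]

theorem stage_congr {c c' : ℕ → M} {n : ℕ} (h : ∀ i < n, c i = c' i) :
    stage A c n = stage A c' n := by
  rw [stage, stage, image_congr (s := Iio n) h]

theorem finite_stage (hA : A.Finite) (c : ℕ → M) (n : ℕ) : (stage A c n).Finite :=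
  hA.union ((finite_Iio n).image c)

theorem stage_mono (c : ℕ → M) : Monotone (stage A c) :=
  fun _ _ h => union_subset_union_right _ (image_mono (Iio_subset_Iio h))

theorem exists_mem_stage {c : ℕ → M} {x : M} (hx : x ∈ A ∪ range c) : ∃ n, x ∈ stage A c n := by
  obtain hx | ⟨n, rfl⟩ := hx
  · exact ⟨0, Or.inl hx⟩
  · exact ⟨n + 1, Or.inr ⟨n, Nat.lt_succ_self n, rfl⟩⟩

/-- The `n`-th term of `c` realizes an isolated type over `A` and the previous terms, and it lies
in the set which `U` provides for the stage and the index that `n` encodes. -/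
def IsGoodTerm (L : FirstOrder.Language.{u, v}) [L.Structure M] (U : Set M → ℕ → Set M)
    (A : Set M) (c : ℕ → M) (n : ℕ) : Prop :=
  (∃ s, IsAtomOver L (stage A c n) s ∧ c n ∈ s) ∧ c n ∈ U (stage A c n.unpair.1) n.unpair.2

theorem IsGoodTerm.congr {U : Set M → ℕ → Set M} {c c' : ℕ → M} {n : ℕ}
    (h : ∀ i ≤ n, c i = c' i) (hc : IsGoodTerm L U A c n) : IsGoodTerm L U A c' n := by
  rw [IsGoodTerm, stage_congr fun i hi => (h i hi.le).symm,
    stage_congr (n := n.unpair.1) fun i hi => (h i (hi.le.trans n.unpair_left_le)).symm, ← h n le_rfl]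
  exact hc

theorem meetsDefinable_of_isGoodTerm {U : Set M → ℕ → Set M} (hA : A.Finite)
    (hU : ∀ A : Set M, A.Finite → ∀ C, A.Definable₁ L C → C.Nonempty → ∃ n, U A n ⊆ C)
    {c : ℕ → M} (hc : ∀ n, IsGoodTerm L U A c n) : L.MeetsDefinable (A ∪ range c) := by
  intro D hne hD
  obtain ⟨A₀, hA₀, hD⟩ := definable_iff_finitely_definable.1 hD
  choose! k hk using fun x (hx : x ∈ (A₀ : Set M)) => exists_mem_stage (hA₀ hx)
  have hsub : (A₀ : Set M) ⊆ stage A c (A₀.sup k) := fun x hx =>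
    stage_mono c (Finset.le_sup (f := k) hx) (hk x hx)
  obtain ⟨j, hj⟩ := hU _ (finite_stage hA c (A₀.sup k)) D (Definable.mono hD hsub) hne
  refine ⟨c (Nat.pair (A₀.sup k) j), hj ?_, Or.inr (mem_range_self _)⟩
  simpa using (hc (Nat.pair (A₀.sup k) j)).2

/-- One step of the construction: an isolated type inside a given definable set has a realization
provided by Neumann's lemma. -/
theorem exists_mem_isAtomOver {T : L.Theory} (hsmall : IsSmall T) (hM : M ⊨ T)
    (hsat : IsOmegaSaturated L M) (hA : A.Finite) (hB : B.Finite) {C : Set M}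
    (hC : A.Definable₁ L C) (hne : C.Nonempty) :
    ∃ x ∈ C, (∃ s, IsAtomOver L A s ∧ x ∈ s) ∧ acl L (insert x A) ∩ acl L B ⊆ acl L A := by
  obtain ⟨s, hsC, hs⟩ := exists_isAtomOver_subset hsmall hM hsat hA hC hne
  obtain ⟨x, hx, hxA⟩ := exists_acl_insert_inter_subset hsat hA hB hs.1 hs.2.1
  exact ⟨x, hsC hx, ⟨s, hs, hx⟩, hxA⟩

theorem exists_isGoodTerm {T : L.Theory} (hsmall : IsSmall T) (hM : M ⊨ T)
    (hsat : IsOmegaSaturated L M) {U : Set M → ℕ → Set M}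
    (hU : ∀ A : Set M, A.Finite → ∀ n, A.Definable₁ L (U A n) ∧ (U A n).Nonempty)
    (hA : A.Finite) (hB : B.Finite) (c : ℕ → M) (n : ℕ) :
    ∃ x, ∀ c' : ℕ → M, (∀ i < n, c' i = c i) → c' n = x →
      IsGoodTerm L U A c' n ∧ acl L (stage A c' (n + 1)) ∩ acl L B ⊆ acl L (stage A c n) := by
  obtain ⟨hC, hne⟩ := hU _ (finite_stage hA c n.unpair.1) n.unpair.2
  obtain ⟨x, hxC, hx, hxB⟩ := exists_mem_isAtomOver hsmall hM hsat (finite_stage hA c n) hB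
    (Definable.mono hC (stage_mono c n.unpair_left_le)) hne
  refine ⟨x, fun c' h h' => ?_⟩
  rw [IsGoodTerm, stage_succ, stage_congr h, h',
    stage_congr fun i hi => h i (hi.trans_le n.unpair_left_le)]
  exact ⟨⟨hx, hxC⟩, hxB⟩

/-- The two models to be constructed are `A ∪ range c` and `B ∪ range d`. Their sequences are chosen
alternately, keeping fixed what is algebraic over both finite stages. -/
theorem exists_two_seqs {T : L.Theory} (hsmall : IsSmall T) (hM : M ⊨ T) [Nonempty M]
    (hsat : IsOmegaSaturated L M) (hA : A.Finite) (hB : B.Finite) :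
    ∃ c d : ℕ → M,
      (∀ n, ∃ s, IsAtomOver L (stage A c n) s ∧ c n ∈ s) ∧
      (∀ n, ∃ s, IsAtomOver L (stage B d n) s ∧ d n ∈ s) ∧
      L.MeetsDefinable (A ∪ range c) ∧ L.MeetsDefinable (B ∪ range d) ∧
      (A ∪ range c) ∩ (B ∪ range d) ⊆ acl L A ∩ acl L B := by
  have : ∀ A : Set M, ∃ U : ℕ → Set M, A.Finite → (∀ n, A.Definable₁ L (U n) ∧ (U n).Nonempty) ∧
      ∀ C, A.Definable₁ L C → C.Nonempty → ∃ n, U n ⊆ C := fun A => by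
    by_cases hA : A.Finite
    · obtain ⟨U, hU⟩ := exists_countable_base hsmall hM hsat hA
      exact ⟨U, fun _ => hU⟩
    · exact ⟨fun _ => ∅, fun h => (hA h).elim⟩
  choose U hU using this
  let R : ℕ → (ℕ → M × M) → Prop := fun n p =>
    acl L (stage A (Prod.fst ∘ p) n) ∩ acl L (stage B (Prod.snd ∘ p) n) ⊆ acl L A ∩ acl L B ∧
    ∀ i < n, IsGoodTerm L U A (Prod.fst ∘ p) i ∧ IsGoodTerm L U B (Prod.snd ∘ p) i
  have hloc : ∀ n p p', (∀ i < n, p i = p' i) → R n p → R n p' := by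
    rintro n p p' h ⟨h₁, h₂⟩
    refine ⟨?_, fun i hi => ?_⟩
    · rwa [stage_congr (c := Prod.fst ∘ p) fun i hi => congrArg Prod.fst (h i hi),
        stage_congr (c := Prod.snd ∘ p) fun i hi => congrArg Prod.snd (h i hi)] at h₁
    · exact ⟨(h₂ i hi).1.congr fun j hj => congrArg Prod.fst (h j (hj.trans_lt hi)),
        (h₂ i hi).2.congr fun j hj => congrArg Prod.snd (h j (hj.trans_lt hi))⟩
  have h₀ : R 0 (Classical.arbitrary _) := ⟨by rw [stage_zero, stage_zero], by simp⟩
  obtain ⟨q, hq⟩ := exists_seq_of_update hloc h₀ fun n p hp => by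
    -- The next term of `c` is chosen against the current stage of `d`,
    -- the next term of `d` against the new stage of `c`.
    obtain ⟨x, hx⟩ := exists_isGoodTerm hsmall hM hsat (fun A hA => (hU A hA).1) hA
      (finite_stage hB (Prod.snd ∘ p) n) (Prod.fst ∘ p) n
    obtain ⟨y, hy⟩ := exists_isGoodTerm hsmall hM hsat (fun A hA => (hU A hA).1) hB
      ((finite_stage hA (Prod.fst ∘ p) n).insert x) (Prod.snd ∘ p) n
    have hupd : ∀ i < n, p i = Function.update p n (x, y) i := fun i hi =>
      (Function.update_of_ne hi.ne _ _).symm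
    obtain ⟨hx₁, hx₂⟩ := hx (Prod.fst ∘ Function.update p n (x, y))
      (fun i hi => congrArg Prod.fst (hupd i hi).symm) (by simp)
    obtain ⟨hy₁, hy₂⟩ := hy (Prod.snd ∘ Function.update p n (x, y))
      (fun i hi => congrArg Prod.snd (hupd i hi).symm) (by simp)
    refine ⟨(x, y), fun z hz => ?_, fun i hi => ?_⟩
    · have hz₁ : z ∈ acl L (insert x (stage A (Prod.fst ∘ p) n)) := by
        have := hz.1
        rwa [stage_succ,
          stage_congr (c := Prod.fst ∘ Function.update p n (x, y)) (c' := Prod.fst ∘ p)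
            fun i hi => congrArg Prod.fst (hupd i hi).symm,
          Function.comp_apply, Function.update_self] at this
      have hzB := hy₂ ⟨hz.2, hz₁⟩
      exact hp.1 ⟨hx₂ ⟨hz.1, hzB⟩, hzB⟩
    · obtain hi | rfl := Nat.lt_succ_iff_lt_or_eq.1 hi
      · exact (hloc n _ _ hupd hp).2 i hi
      · exact ⟨hx₁, hy₁⟩
  have hc : ∀ n, IsGoodTerm L U A (Prod.fst ∘ q) n := fun n => ((hq (n + 1)).2 n n.lt_succ_self).1
  have hd : ∀ n, IsGoodTerm L U B (Prod.snd ∘ q) n := fun n => ((hq (n + 1)).2 n n.lt_succ_self).2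
  refine ⟨_, _, fun n => (hc n).1, fun n => (hd n).1,
    meetsDefinable_of_isGoodTerm hA (fun A hA => (hU A hA).2) hc,
    meetsDefinable_of_isGoodTerm hB (fun A hA => (hU A hA).2) hd, ?_⟩
  rintro z ⟨hz₁, hz₂⟩
  obtain ⟨m, hm⟩ := exists_mem_stage hz₁
  obtain ⟨n, hn⟩ := exists_mem_stage hz₂
  exact (hq (max m n)).1 ⟨subset_acl (stage_mono _ (le_max_left m n) hm),
    subset_acl (stage_mono _ (le_max_right m n) hn)⟩

/-! ### Models constructed by isolated types are prime -/

/-- If two tuples have the same type and the first exhausts its structure, then sending the first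
to the second is an elementary embedding. -/
theorem exists_elementaryEmbedding {N : Type*} [L.Structure N] {K : Type*} [L.Structure K]
    {ι : Type*} {p : ι → N} (hp : Function.Surjective p) {q : ι → K}
    (h : ∀ φ : L.Formula ι, φ.Realize p ↔ φ.Realize q) : ∃ g : N ↪ₑ[L] K, ∀ i, g (p i) = q i := by
  have hpr := Function.rightInverse_surjInv hp
  refine ⟨⟨q ∘ Function.surjInv hp, fun n φ x => ?_⟩, fun i => ?_⟩
  · have := h (φ.relabel (Function.surjInv hp ∘ x))
    rw [Formula.realize_relabel, Formula.realize_relabel] at this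
    rw [Function.comp_assoc, ← this, ← Function.comp_assoc, hpr.comp_eq_id, Function.id_comp]
  · have := h ((Term.var (Function.surjInv hp (p i))).equal (Term.var i))
    change q (Function.surjInv hp (p i)) = q i
    simpa [hpr (p i)] using this

/-- A formula mentions only finitely many terms of a sequence, so two sequences over given tuples
have the same type as soon as their initial segments do. -/
theorem realize_iff_of_forall_fin {N : Type*} [L.Structure N] {K : Type*} [L.Structure K]
    {β : Type*} {v : β → N} {f : β → K} {c : ℕ → N} {q : ℕ → K}
    (h : ∀ n (φ : L.Formula (β ⊕ Fin n)), φ.Realize (Sum.elim v fun i => c i) ↔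
      φ.Realize (Sum.elim f fun i => q i))
    (φ : L.Formula (β ⊕ ℕ)) : φ.Realize (Sum.elim v c) ↔ φ.Realize (Sum.elim f q) := by
  classical
  let n := φ.freeVarFinset.sup (Sum.elim (fun _ => 0) id)
  let r : φ.freeVarFinset → β ⊕ Fin (n + 1) := fun i => Sum.map id (Fin.ofNat (n + 1)) i
  have key : ∀ i : φ.freeVarFinset, Sum.map id (fun j : Fin (n + 1) => (j : ℕ)) (r i) = i := by
    rintro ⟨i | i, hi⟩
    · rfl
    · have : i ≤ n := Finset.le_sup (f := Sum.elim (fun _ => 0) id) hi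
      simp [r, Nat.mod_eq_of_lt (Nat.lt_succ_of_le this)]
  have := h (n + 1) (φ.restrictFreeVar r)
  rwa [Formula.Realize, Formula.Realize,
    BoundedFormula.realize_restrictFreeVar (Sum.elim v c) fun i => by
      rw [← key i]; cases r i <;> rfl,
    BoundedFormula.realize_restrictFreeVar (Sum.elim f q) fun i => by
      rw [← key i]; cases r i <;> rfl] at this

/-- If every term of `c` realizes an isolated type over `A` and the previous terms, then every
elementary map on `A` extends to `A ∪ range c`, one term at a time. -/
theorem exists_seq_realize_iff {β : Type*} {v : β → M} {c : ℕ → M}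
    (hc : ∀ n, ∃ s, IsAtomOver L (stage (range v) c n) s ∧ c n ∈ s)
    {K : Type*} [L.Structure K] {f : β → K}
    (hf : ∀ φ : L.Formula β, φ.Realize v ↔ φ.Realize f) :
    ∃ q : ℕ → K, ∀ φ : L.Formula (β ⊕ ℕ),
      φ.Realize (Sum.elim v c) ↔ φ.Realize (Sum.elim f q) := by
  have hK : Nonempty K := by
    have := hf ((⊤ : L.Formula (β ⊕ Fin 1)).iExs (Fin 1))
    rw [Formula.realize_iExs, Formula.realize_iExs] at this
    obtain ⟨x, -⟩ := this.1 ⟨fun _ => c 0, Formula.realize_top.2 trivial⟩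
    exact ⟨x 0⟩
  let R : ℕ → (ℕ → K) → Prop := fun n q => ∀ φ : L.Formula (β ⊕ Fin n),
    φ.Realize (Sum.elim v fun i => c i) ↔ φ.Realize (Sum.elim f fun i => q i)
  have hloc : ∀ n p p', (∀ i < n, p i = p' i) → R n p → R n p' := by
    intro n p p' h hp φ
    rw [hp φ, show (fun i : Fin n => p i) = fun i : Fin n => p' i from funext fun i => h i i.2]
  have h₀ : R 0 (Classical.arbitrary _) := fun φ => by
    have := hf (φ.relabel (Sum.elim id finZeroElim))
    rw [Formula.realize_relabel, Formula.realize_relabel] at this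
    convert this using 2 <;> ext (i | i) <;> first | rfl | exact i.elim0
  obtain ⟨q, hq⟩ := exists_seq_of_update hloc h₀ fun n p hp => by
    obtain ⟨s, ⟨hs, -, hatom⟩, hcs⟩ := hc n
    have hst : stage (range v) c n = range (Sum.elim v fun i : Fin n => c i) := by
      rw [Sum.elim_range, stage]
      congr 1
      ext y
      simp [Fin.exists_iff]
    rw [hst] at hs hatom
    obtain ⟨ψ, hψ⟩ := definable₁_range_iff.1 hs
    obtain ⟨x, hx⟩ : ∃ x : Fin 1 → K, ψ.Realize (Sum.elim (Sum.elim f fun i : Fin n => p i) x) := by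
      rw [← Formula.realize_iExs, ← hp, Formula.realize_iExs]
      exact ⟨_, (hψ _).1 hcs⟩
    refine ⟨x 0, ?_⟩
    let r : β ⊕ Fin (n + 1) → (β ⊕ Fin n) ⊕ Fin 1 :=
      Sum.elim (Sum.inl ∘ Sum.inl) (Fin.lastCases (Sum.inr 0) (Sum.inl ∘ Sum.inr))
    have hrM : Sum.elim v (fun i : Fin (n + 1) => c i) =
        Sum.elim (Sum.elim v fun i : Fin n => c i) (fun _ => c n) ∘ r := by
      ext (i | i)
      · rfl
      · cases i using Fin.lastCases <;> simp [r]
    have hrK : Sum.elim f (fun i : Fin (n + 1) => Function.update p n (x 0) i) =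
        Sum.elim (Sum.elim f fun i : Fin n => p i) x ∘ r := by
      ext (i | i)
      · rfl
      · cases i using Fin.lastCases with
        | last => simp [r]
        | cast i => simp [r, i.2.ne]
    -- As `ψ` isolates the type of `c n`, it implies every formula true of `c n`.
    have key : ∀ φ : L.Formula (β ⊕ Fin (n + 1)), φ.Realize (Sum.elim v fun i => c i) →
        φ.Realize (Sum.elim f fun i => Function.update p n (x 0) i) := by
      intro φ hφ
      rw [hrM, ← Formula.realize_relabel] at hφ
      rw [hrK, ← Formula.realize_relabel]
      have hsub := hatom {y | (φ.relabel r).Realize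
        (Sum.elim (Sum.elim v fun i : Fin n => c i) fun _ => y)}
        (definable₁_range_iff.2 ⟨_, fun _ => Iff.rfl⟩) ⟨c n, hcs, hφ⟩
      have hall := hp ((ψ.imp (φ.relabel r)).iAlls (Fin 1))
      rw [Formula.realize_iAlls, Formula.realize_iAlls] at hall
      refine Formula.realize_imp.1 (hall.1 (fun y => Formula.realize_imp.2 fun hy => ?_) x) hx
      have hy0 : (fun _ => y 0) = y := funext fun i => by rw [Subsingleton.elim i 0]
      have := hsub ((hψ (y 0)).2 (by rwa [hy0]))
      rwa [mem_ofPred_eq, hy0] at this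
    refine fun φ => ⟨key φ, fun h => ?_⟩
    by_contra hn
    exact Formula.realize_not.1 (key φ.not (Formula.realize_not.2 hn)) h
  exact ⟨q, realize_iff_of_forall_fin hq⟩

theorem isPrimeOver_of_isAtomOver {c : ℕ → M} (S : L.ElementarySubstructure M)
    (hS : (S : Set M) = A ∪ range c) (hc : ∀ n, ∃ s, IsAtomOver L (stage A c n) s ∧ c n ∈ s) :
    IsPrimeOver L S ((↑) ⁻¹' A : Set S) := by
  intro K _ f hf
  let v : ((↑) ⁻¹' A : Set S) → M := fun x => (x : S)
  have hmem : ∀ {x}, x ∈ S ↔ x ∈ A ∪ range c := by rw [← hS]; rfl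
  have hv : range v = A := by
    ext x
    constructor
    · rintro ⟨y, rfl⟩
      exact y.2
    · intro hx
      exact ⟨⟨⟨x, hmem.2 (Or.inl hx)⟩, hx⟩, rfl⟩
  have hcS : ∀ n, c n ∈ S := fun n => hmem.2 (Or.inr (mem_range_self n))
  obtain ⟨q, hq⟩ := exists_seq_realize_iff (v := v) (f := f) (hv.symm ▸ hc) fun φ =>
    (S.subtype.map_formula φ _).trans (hf φ)
  obtain ⟨g, hg⟩ := exists_elementaryEmbedding (L := L) (p := Sum.elim (↑) fun n => ⟨c n, hcS n⟩)
    (q := Sum.elim f q) (N := S) (by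
      rintro ⟨x, hx⟩
      obtain hxA | ⟨n, rfl⟩ := hmem.1 hx
      · exact ⟨Sum.inl ⟨⟨x, hx⟩, hxA⟩, rfl⟩
      · exact ⟨Sum.inr n, rfl⟩) fun φ => by
    rw [← hq φ, ← S.subtype.map_formula]
    congr! 1
    ext (i | i) <;> rfl
  exact ⟨g, fun x => hg (Sum.inl x)⟩

theorem mem_HPrime {c : ℕ → M} (hA : A.Finite) (hN : L.MeetsDefinable (A ∪ range c))
    (hc : ∀ n, ∃ s, IsAtomOver L (stage A c n) s ∧ c n ∈ s) : A ∪ range c ∈ HPrime L M := by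
  have hS : (hN.toElementarySubstructure : Set M) = A ∪ range c := hN.closure_eq_self
  refine ⟨⟨⟨_, hS⟩, ?_⟩, _, hS, _, hA.preimage Subtype.val_injective.injOn,
    isPrimeOver_of_isAtomOver _ hS hc⟩
  rw [← succ_aleph0, Order.lt_succ_iff, le_aleph0_iff_set_countable]
  exact hA.countable.union (countable_range c)

/-- Finite subsets `A` and `B` of an `ω`-saturated model of a small theory are contained in
countable elementary submodels, prime over finite sets, whose common points are algebraic over
both `A` and `B`. -/
theorem exists_mem_HPrime_inter_subset {T : L.Theory} (hsmall : IsSmall T) (hM : M ⊨ T) [Nonempty M]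
    (hsat : IsOmegaSaturated L M) (hA : A.Finite) (hB : B.Finite) :
    ∃ N₁ ∈ HPrime L M, ∃ N₂ ∈ HPrime L M, A ⊆ N₁ ∧ B ⊆ N₂ ∧ N₁ ∩ N₂ ⊆ acl L A ∩ acl L B := by
  obtain ⟨c, d, hc, hd, hcM, hdM, hcd⟩ := exists_two_seqs hsmall hM hsat hA hB
  exact ⟨_, mem_HPrime hA hcM hc, _, mem_HPrime hB hdM hd, subset_union_left, subset_union_left, hcd⟩

end Construction

end ModelHypergraph

/-! ### Separability -/

open ModelHypergraph

theorem mainTheorem5 {L : FirstOrder.Language.{u, v}} (T : L.Theory) (hT : T.IsComplete)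
    (hsmall : ModelHypergraph.IsSmall T)
    (M : Type w) [L.Structure M] (hM : M ⊨ T)
    (hsat : ModelHypergraph.IsOmegaSaturated L M)
    (Z₀ Z : Set M) (hZ₀ : Z₀.Finite) (hZ : Z = ModelHypergraph.acl L Z₀)
    (a b : M) (ha : a ∉ Z) (hb : b ∉ Z) :
    [ModelHypergraph.HausdorffSeparableOver (ModelHypergraph.H L M) Z a b,
      ModelHypergraph.HausdorffSeparableOver (ModelHypergraph.HCard L M ℵ₁) Z a b,
      ModelHypergraph.HausdorffSeparableOver (ModelHypergraph.HPrime L M) Z a b,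
      (ModelHypergraph.acl L (insert a Z) ∩ ModelHypergraph.acl L (insert b Z)) \ Z = ∅].TFAE ∧
    [ModelHypergraph.SeparableOver (ModelHypergraph.H L M) Z a b,
      ModelHypergraph.SeparableOver (ModelHypergraph.HCard L M ℵ₁) Z a b,
      ModelHypergraph.SeparableOver (ModelHypergraph.HPrime L M) Z a b,
      b ∉ ModelHypergraph.acl L (insert a Z)].TFAE := by
  have : Nonempty M := ⟨a⟩
  have hZ₀Z : Z₀ ⊆ Z := hZ ▸ subset_acl
  have hacl : ∀ x, acl L (insert x Z₀) ⊆ acl L (insert x Z) := fun x =>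
    acl_mono (Set.insert_subset_insert hZ₀Z)
  have hZN : ∀ {N : Set M}, N ∈ HPrime L M → Z₀ ⊆ N → Z ⊆ N := fun hN h =>
    hZ ▸ acl_subset_of_mem_H hN.1.1 h
  constructor
  · tfae_have 3 → 2 := fun ⟨y, hy, z, hz, h⟩ => ⟨y, hy.1, z, hz.1, h⟩
    tfae_have 2 → 1 := fun ⟨y, hy, z, hz, h⟩ => ⟨y, hy.1, z, hz.1, h⟩
    tfae_have 1 → 4 := by
      rintro ⟨y, hy, z, hz, hZy, hZz, h, hay, hbz⟩
      rw [Set.sdiff_eq_empty] at h ⊢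
      exact (Set.inter_subset_inter (acl_subset_of_mem_H hy (Set.insert_subset hay hZy))
        (acl_subset_of_mem_H hz (Set.insert_subset hbz hZz))).trans h
    tfae_have 4 → 3 := by
      intro h
      obtain ⟨y, hy, z, hz, hay, hbz, hyz⟩ := exists_mem_HPrime_inter_subset hsmall hM hsat
        (hZ₀.insert a) (hZ₀.insert b)
      rw [Set.insert_subset_iff] at hay hbz
      refine ⟨y, hy, z, hz, hZN hy hay.2, hZN hz hbz.2, ?_, hay.1, hbz.1⟩
      rw [Set.sdiff_eq_empty] at h ⊢
      exact hyz.trans ((Set.inter_subset_inter (hacl a) (hacl b)).trans h)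
    tfae_finish
  · tfae_have 3 → 2 := fun ⟨y, hy, h⟩ => ⟨y, hy.1, h⟩
    tfae_have 2 → 1 := fun ⟨y, hy, h⟩ => ⟨y, hy.1, h⟩
    tfae_have 1 → 4 := by
      rintro ⟨y, hy, hZy, hay, hby⟩ hb'
      rw [Set.union_eq_self_of_subset_right hZy] at hay
      exact hby (acl_subset_of_mem_H hy (Set.insert_subset hay hZy) hb')
    tfae_have 4 → 3 := by
      intro h
      obtain ⟨y, hy, z, -, hay, hbz, hyz⟩ := exists_mem_HPrime_inter_subset hsmall hM hsat
        (hZ₀.insert a) (Set.finite_singleton b)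
      rw [Set.insert_subset_iff] at hay
      exact ⟨y, hy, hZN hy hay.2, Or.inl hay.1, fun hby =>
        h (hacl a (hyz ⟨hby, hbz rfl⟩).1)⟩
    tfae_finish
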